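/- Let $\Gamma$ be a weighted digraph without loops on the vertex set $\{1,\dots,n\}$, $n>1$, with matrix of arc weights $W=(w_{ij})$, where $w_{ij}>0$ if there is an arc from $i$ to $j$ and $w_{ij}=0$ otherwise. Its Laplacian matrix $L=(\ell_{ij})$ is given by $\ell_{ij}=-w_{ij}$ for $j\neq i$ and $\ell_{ii}=-\sum_{k\neq i}\ell_{ik}$. A converging tree is a weakly connected digraph in which one vertex (the root, to which the tree converges) has outdegree zero and every other vertex has outdegree one. An in-forest of $\Gamma$ is a spanning subgraph of $\Gamma$ each of whose weak components is a converging tree; its weight is the product of the weights of its arcs (and $1$ if it has no arcs). Let $d$ be the minimum number of trees in an in-forest of $\Gamma$, so that $n-d$ is the maximum number of arcs in an in-forest. Let $\sigma_{n-d}$ be the total weight of all in-forests of $\Gamma$ with $n-d$ arcs, let $Q_{n-d}$ be the $n\times n$ matrix whose $(i,j)$ entry is the total weight of those in-forests with $n-d$ arcs in which $i$ belongs to a tree converging to $j$, and let $\tilde J=\sigma_{n-d}^{-1}Q_{n-d}$ be the normalized matrix of maximum in-forests. Denote by $A^*$ the conjugate transpose of a matrix $A$, and by $A^+$ its Moore–Penrose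 inverse, i.e. the unique matrix $X$ such that $AXA=A$, $XAX=X$, $(AX)^*=AX$ and $(XA)^*=XA$. Then the matrix $Z=L+\tilde J^*$ is nonsingular, the matrices $ZZ^*$ and $\tilde J^*\tilde J+LL^*$ are nonsingular, and $$L^+=L^*(ZZ^*)^{-1}=L^*(\tilde J^*\tilde J+LL^*)^{-1}.$$ -/

import Mathlib

open scoped Matrix

/-- A weighted digraph without loops on the vertex set `V`, given by its matrix of arc weights:
`weight i j` is strictly positive if there is an arc from `i` to `j`, and zero otherwise. -/
structure WeightedDigraph (V : Type*) where
  weight : V → V → ℝ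
  weight_nonneg : ∀ i j, 0 ≤ weight i j
  weight_self : ∀ i, weight i i = 0

/-- Two vertices are weakly connected by a set `F` of arcs if they are joined in the underlying
undirected graph of the digraph with arc set `F`. -/
def WeaklyConnected {V : Type*} (F : Finset (V × V)) : V → V → Prop :=
  Relation.EqvGen fun i j => (i, j) ∈ F

/-- The outdegree of a vertex in the digraph with arc set `F`. -/
def outdegree {V : Type*} [DecidableEq V] (F : Finset (V × V)) (v : V) : ℕ :=
  (F.filter fun a => a.1 = v).card

open Classical in
/-- The vertex set of the weak component of `v` in the digraph on `V` with arc set `F`. -/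
noncomputable def weakComponent {V : Type*} [Fintype V] (F : Finset (V × V)) (v : V) : Finset V :=
  Finset.univ.filter fun u => WeaklyConnected F v u

/-- The weak component of `i` in the digraph with arc set `F` is a tree converging to `j`: it
contains `j`, the vertex `j` has outdegree zero and all other vertices of the component have
outdegree one. (All arcs of `F` that leave a vertex of the component stay in the component, and the
component is weakly connected by definition.) -/
def ConvergesTo {V : Type*} [Fintype V] [DecidableEq V] (F : Finset (V × V)) (i j : V) : Prop :=
  j ∈ weakComponent F i ∧ outdegree F j = 0 ∧
    ∀ u ∈ weakComponent F i, u ≠ j → outdegree F u = 1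

/-- The digraph with vertex set `V` and arc set `F` is a converging forest: each of its weak
components is a converging tree. -/
def IsConvergingForest {V : Type*} [Fintype V] [DecidableEq V] (F : Finset (V × V)) : Prop :=
  ∀ i : V, ∃ j : V, ConvergesTo F i j

open Classical in
/-- The number of weak components of the digraph on `V` with arc set `F`; for a converging forest,
this is the number of its trees. -/
noncomputable def numComponents {V : Type*} [Fintype V] (F : Finset (V × V)) : ℕ :=
  (Finset.univ.image (weakComponent F)).card

namespace WeightedDigraph

/-- The Laplacian matrix: the off-diagonal entries are `-w_ij`, and all row sums are zero. -/
def laplacian {V : Type*} [Fintype V] [DecidableEq V] (Γ : WeightedDigraph V) : Matrix V V ℝ :=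
  Matrix.of fun i j => if j = i then ∑ k ∈ Finset.univ.erase i, Γ.weight i k else -Γ.weight i j

open Classical in
/-- The set of arcs. -/
noncomputable def arcs {V : Type*} [Fintype V] (Γ : WeightedDigraph V) : Finset (V × V) :=
  Finset.univ.filter fun a => 0 < Γ.weight a.1 a.2

open Classical in
/-- The finite set of all in-forests (spanning converging forests) of `Γ`, each given by its set of
arcs. -/
noncomputable def inForests {V : Type*} [Fintype V] [DecidableEq V] (Γ : WeightedDigraph V) :
    Finset (Finset (V × V)) :=
  Γ.arcs.powerset.filter IsConvergingForest

/-- The weight of a subgraph: the product of the weights of its arcs. -/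
def subgraphWeight {V : Type*} (Γ : WeightedDigraph V) (F : Finset (V × V)) : ℝ :=
  ∏ a ∈ F, Γ.weight a.1 a.2

/-- `σ_k`, the total weight of the in-forests with `k` arcs. -/
noncomputable def sigma {V : Type*} [Fintype V] [DecidableEq V] (Γ : WeightedDigraph V) (k : ℕ) :
    ℝ :=
  ∑ F ∈ Γ.inForests.filter (fun F => F.card = k), Γ.subgraphWeight F

open Classical in
/-- `Q_k`, the matrix of in-forests with `k` arcs: its `(i, j)` entry is the total weight of the
in-forests with `k` arcs in which `i` belongs to a tree converging to `j`. -/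
noncomputable def forestMatrix {V : Type*} [Fintype V] [DecidableEq V] (Γ : WeightedDigraph V)
    (k : ℕ) : Matrix V V ℝ :=
  Matrix.of fun i j =>
    ∑ F ∈ Γ.inForests.filter (fun F => F.card = k ∧ ConvergesTo F i j), Γ.subgraphWeight F

/-- `J_k = σ_k⁻¹ Q_k`, the normalized matrix of in-forests with `k` arcs. -/
noncomputable def normalizedForestMatrix {V : Type*} [Fintype V] [DecidableEq V]
    (Γ : WeightedDigraph V) (k : ℕ) : Matrix V V ℝ :=
  (Γ.sigma k)⁻¹ • Γ.forestMatrix k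

/-- The in-forest dimension `d`: the minimum possible number of trees in an in-forest. (The set is
never empty, since the subgraph without arcs is an in-forest.) -/
noncomputable def inForestDimension {V : Type*} [Fintype V] [DecidableEq V]
    (Γ : WeightedDigraph V) : ℕ :=
  sInf {m | ∃ F ∈ Γ.inForests, numComponents F = m}

/-- The normalized matrix `J_{n-d}` of maximum in-forests. An in-forest with `m` trees has `n - m`
arcs, so that the maximum number of arcs in an in-forest is `n - d`. -/
noncomputable def maxForestMatrix {V : Type*} [Fintype V] [DecidableEq V]
    (Γ : WeightedDigraph V) : Matrix V V ℝ :=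
  Γ.normalizedForestMatrix (Fintype.card V - Γ.inForestDimension)

end WeightedDigraph

/-- `X` satisfies the four equations that define the Moore–Penrose inverse of `A`. -/
structure IsMoorePenroseInverse {𝕜 : Type*} [RCLike 𝕜] {m n : Type*} [Fintype m] [Fintype n]
    (A : Matrix m n 𝕜) (X : Matrix n m 𝕜) : Prop where
  mul_mul_self : A * X * A = A
  mul_mul_inv : X * A * X = X
  conjTranspose_mul : (A * X)ᴴ = A * X
  conjTranspose_mul_inv : (X * A)ᴴ = X * A

/-! The combinatorial input is the recurrence `L Q_k = σ_{k+1} I - Q_{k+1}`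
(`laplacian_mul_forestMatrix`). In `(L Q_k)_{ij}`, the forests in which `i` is a root produce, on
adding an arc `(i, m)` into another tree, exactly the forests with `k + 1` arcs in which `i` is not
a root; the remaining forests cancel in pairs by exchanging the arc that leaves `i`.

No in-forest has more than `n - d` arcs, so the recurrence at `k = n - d` gives `L J = 0`. It also
makes each `Q_k` a polynomial in `L`, whence `J L = 0`. One step lower it gives `I - J = L N` for
some `N`.

The rest is linear algebra. Since `L J = 0`, the cross terms of `Z Z*` vanish and `Z Z* = J* J + L
L*`. If `Z* x = 0`, then `J x = 0` and `L* x = 0`; the latter gives `x = J* x`, so `x` is orthogonal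
to itself and `Z` is nonsingular. Finally `J L = 0` makes `M = J* J + L L*` commute with `L L*` and
agree with it on the range of `L`, which yields the Penrose equations for `L* M⁻¹`. -/

section Forests

variable {V : Type*}

/-! ### Reachability, weak connectivity and outdegrees. -/

lemma WeaklyConnected.of_reaches {F : Finset (V × V)} {u v : V}
    (h : Relation.ReflTransGen (fun a b => (a, b) ∈ F) u v) : WeaklyConnected F u v := by
  induction h with
  | refl => exact Relation.EqvGen.refl _
  | tail _ h ih => exact Relation.EqvGen.trans _ _ _ ih (Relation.EqvGen.rel _ _ h)

lemma reaches_mono {F G : Finset (V × V)} (h : F ⊆ G) {u v : V}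
    (huv : Relation.ReflTransGen (fun a b => (a, b) ∈ F) u v) :
    Relation.ReflTransGen (fun a b => (a, b) ∈ G) u v := by
  induction huv with
  | refl => exact .refl
  | tail _ hab ih => exact ih.tail (h hab)

lemma mem_weakComponent [Fintype V] {F : Finset (V × V)} {u v : V} :
    u ∈ weakComponent F v ↔ WeaklyConnected F v u := by
  simp [weakComponent]

lemma weakComponent_eq_iff [Fintype V] {F : Finset (V × V)} {u v : V} :
    weakComponent F u = weakComponent F v ↔ WeaklyConnected F u v := by
  constructor
  · intro h
    rw [← mem_weakComponent, h, mem_weakComponent]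
    exact Relation.EqvGen.refl _
  · intro h
    ext x
    rw [mem_weakComponent, mem_weakComponent]
    exact ⟨fun hx => Relation.EqvGen.trans _ _ _ (Relation.EqvGen.symm _ _ h) hx,
      fun hx => Relation.EqvGen.trans _ _ _ h hx⟩

variable [DecidableEq V]

lemma outdegree_eq_zero_iff {F : Finset (V × V)} {v : V} :
    outdegree F v = 0 ↔ ∀ u, (v, u) ∉ F := by
  rw [outdegree, Finset.card_eq_zero, Finset.filter_eq_empty_iff]
  exact ⟨fun h u hu => h hu rfl, fun h a ha hav => h a.2 (by rw [← hav]; exact ha)⟩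

lemma outdegree_le_one_iff {F : Finset (V × V)} {v : V} :
    outdegree F v ≤ 1 ↔ ∀ a b, (v, a) ∈ F → (v, b) ∈ F → a = b := by
  rw [outdegree, Finset.card_le_one]
  constructor
  · intro h a b ha hb
    exact congrArg Prod.snd (h (v, a) (by simp [ha]) (v, b) (by simp [hb]))
  · rintro h ⟨a, b⟩ hab ⟨c, d⟩ hcd
    simp only [Finset.mem_filter] at hab hcd
    obtain ⟨hab, rfl⟩ := hab
    obtain ⟨hcd, rfl⟩ := hcd
    rw [h _ _ hab hcd]

lemma outdegree_mono {F G : Finset (V × V)} (h : F ⊆ G) (v : V) :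
    outdegree F v ≤ outdegree G v :=
  Finset.card_le_card (Finset.filter_subset_filter _ h)

lemma outdegree_insert_of_ne {F : Finset (V × V)} {i m v : V} (h : v ≠ i) :
    outdegree (insert (i, m) F) v = outdegree F v := by
  rw [outdegree, Finset.filter_insert, if_neg (fun h' => h h'.symm), outdegree]

lemma outdegree_insert_self {F : Finset (V × V)} {i m : V} (hi : outdegree F i = 0) :
    outdegree (insert (i, m) F) i = 1 := by
  rw [outdegree, Finset.card_eq_zero] at hi
  rw [outdegree, Finset.filter_insert, if_pos rfl, hi]
  rfl

/-- With outdegrees at most one, walks are forced: a walk from the tail of an arc to a sink must use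
that arc. Hence both ends of an arc reach the same sinks, and this passes to the generated
equivalence relation. -/
lemma reaches_of_weaklyConnected {F : Finset (V × V)} (hF : ∀ v, outdegree F v ≤ 1)
    {r : V} (hr : outdegree F r = 0) {u v : V} (h : WeaklyConnected F u v) :
    Relation.ReflTransGen (fun a b => (a, b) ∈ F) u r ↔
      Relation.ReflTransGen (fun a b => (a, b) ∈ F) v r := by
  induction h with
  | rel a b hab =>
    constructor
    · intro h
      rcases Relation.ReflTransGen.cases_head h with rfl | ⟨c, hac, hc⟩
      · exact absurd hab (outdegree_eq_zero_iff.1 hr b)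
      · rwa [outdegree_le_one_iff.1 (hF a) _ _ hab hac]
    · exact fun h => Relation.ReflTransGen.head hab h
  | refl => rfl
  | symm _ _ _ ih => exact ih.symm
  | trans _ _ _ _ _ ih₁ ih₂ => exact ih₁.trans ih₂

variable [Fintype V]

/-! ### Converging forests as acyclic partial functions. -/

lemma convergesTo_of_reaches {F : Finset (V × V)} (hF : ∀ v, outdegree F v ≤ 1) {i r : V}
    (h : Relation.ReflTransGen (fun a b => (a, b) ∈ F) i r) (hr : outdegree F r = 0) :
    ConvergesTo F i r := by
  refine ⟨mem_weakComponent.2 (.of_reaches h), hr, fun u hu hur => ?_⟩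
  have hu' := (reaches_of_weaklyConnected hF hr (mem_weakComponent.1 hu)).1 h
  rcases Relation.ReflTransGen.cases_head hu' with rfl | ⟨c, hac, -⟩
  · exact absurd rfl hur
  · have h1 := hF u
    have h0 : outdegree F u ≠ 0 := fun h0 => outdegree_eq_zero_iff.1 h0 c hac
    omega

lemma ConvergesTo.unique {F : Finset (V × V)} {i r s : V} (hr : ConvergesTo F i r)
    (hs : ConvergesTo F i s) : r = s := by
  by_contra h
  have := hs.2.2 r hr.1 h
  rw [hr.2.1] at this
  exact zero_ne_one this

lemma IsConvergingForest.outdegree_le_one {F : Finset (V × V)} (hF : IsConvergingForest F)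
    (v : V) : outdegree F v ≤ 1 := by
  obtain ⟨r, hr⟩ := hF v
  by_cases h : v = r
  · subst h; rw [hr.2.1]; exact zero_le_one
  · exact (hr.2.2 v (mem_weakComponent.2 (Relation.EqvGen.refl _)) h).le

lemma IsConvergingForest.convergesTo_iff {F : Finset (V × V)} (hF : IsConvergingForest F)
    {i r : V} : ConvergesTo F i r ↔
      Relation.ReflTransGen (fun a b => (a, b) ∈ F) i r ∧ outdegree F r = 0 := by
  refine ⟨fun h => ⟨?_, h.2.1⟩, fun h => convergesTo_of_reaches hF.outdegree_le_one h.1 h.2⟩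
  exact (reaches_of_weaklyConnected hF.outdegree_le_one h.2.1 (mem_weakComponent.1 h.1)).2 .refl

lemma isConvergingForest_of_reaches {F : Finset (V × V)} (hF : ∀ v, outdegree F v ≤ 1)
    (h : ∀ v, ∃ r, Relation.ReflTransGen (fun a b => (a, b) ∈ F) v r ∧ outdegree F r = 0) :
    IsConvergingForest F := fun i =>
  let ⟨r, hr, hr0⟩ := h i
  ⟨r, convergesTo_of_reaches hF hr hr0⟩

lemma IsConvergingForest.convergesTo_self_iff {F : Finset (V × V)} (hF : IsConvergingForest F)
    {i : V} : ConvergesTo F i i ↔ outdegree F i = 0 :=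
  ⟨fun h => h.2.1, fun h => hF.convergesTo_iff.2 ⟨.refl, h⟩⟩

lemma IsConvergingForest.convergesTo_of_root {F : Finset (V × V)} (hF : IsConvergingForest F)
    {i : V} (hi : outdegree F i = 0) (j : V) : ConvergesTo F i j ↔ i = j :=
  ⟨fun h => (hF.convergesTo_self_iff.2 hi).unique h,
    fun h => h ▸ hF.convergesTo_self_iff.2 hi⟩

/-- A path from `m` back to `i` would close a cycle. As walks are forced, every vertex on the walk
from `m` to its root could still reach `i`, so the root itself would have an outgoing arc. -/
lemma IsConvergingForest.not_reaches_of_arc {G : Finset (V × V)} (hG : IsConvergingForest G)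
    {i m : V} (him : (i, m) ∈ G) : ¬ Relation.ReflTransGen (fun a b => (a, b) ∈ G) m i := by
  intro h
  obtain ⟨r, hr⟩ := hG m
  obtain ⟨hmr, hr0⟩ := hG.convergesTo_iff.1 hr
  have key : Relation.ReflTransGen (fun a b => (a, b) ∈ G) r i := by
    clear hr hr0
    induction hmr with
    | refl => exact h
    | @tail v v' _ hv ih =>
      rcases Relation.ReflTransGen.cases_head ih with rfl | ⟨c, hac, hc⟩
      · rwa [outdegree_le_one_iff.1 (hG.outdegree_le_one v) _ _ hv him]
      · rwa [outdegree_le_one_iff.1 (hG.outdegree_le_one v) _ _ hv hac]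
  rcases Relation.ReflTransGen.cases_head key with rfl | ⟨c, hac, -⟩
  · exact outdegree_eq_zero_iff.1 hr0 _ him
  · exact outdegree_eq_zero_iff.1 hr0 _ hac

/-! ### Deleting and adding an arc at a vertex. -/

lemma IsConvergingForest.outdegree_erase {G : Finset (V × V)} (hG : IsConvergingForest G)
    {i m : V} (him : (i, m) ∈ G) : outdegree (G.erase (i, m)) i = 0 := by
  rw [outdegree_eq_zero_iff]
  intro u hu
  rw [Finset.mem_erase] at hu
  exact hu.1 (by rw [outdegree_le_one_iff.1 (hG.outdegree_le_one i) _ _ hu.2 him])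

/-- A walk to the old root either avoids `i` and survives, or is cut at `i`, which has become a
root. -/
lemma IsConvergingForest.erase {G : Finset (V × V)} (hG : IsConvergingForest G)
    {i m : V} (him : (i, m) ∈ G) : IsConvergingForest (G.erase (i, m)) := by
  refine isConvergingForest_of_reaches
    (fun v => (outdegree_mono (Finset.erase_subset _ _) v).trans (hG.outdegree_le_one v))
    fun v => ?_
  obtain ⟨r, hr⟩ := hG v
  obtain ⟨hvr, hr0⟩ := hG.convergesTo_iff.1 hr
  clear hr
  induction hvr using Relation.ReflTransGen.head_induction_on with
  | refl => exact ⟨r, .refl, Nat.le_zero.1 (hr0 ▸ outdegree_mono (Finset.erase_subset _ _) r)⟩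
  | @head v v' hv _ ih =>
    by_cases hi : v = i
    · exact ⟨i, hi ▸ .refl, hG.outdegree_erase him⟩
    · obtain ⟨x, hx, hx0⟩ := ih
      refine ⟨x, .head (Finset.mem_erase.2 ⟨fun h => hi (congrArg Prod.fst h), hv⟩) hx, hx0⟩

lemma IsConvergingForest.not_convergesTo_erase {G : Finset (V × V)} (hG : IsConvergingForest G)
    {i m : V} (him : (i, m) ∈ G) : ¬ ConvergesTo (G.erase (i, m)) m i := fun h =>
  hG.not_reaches_of_arc him <|
    reaches_mono (Finset.erase_subset _ _) ((hG.erase him).convergesTo_iff.1 h).1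

lemma outdegree_insert_le_one {F : Finset (V × V)} (hF : IsConvergingForest F) {i m : V}
    (hi : outdegree F i = 0) (v : V) : outdegree (insert (i, m) F) v ≤ 1 := by
  by_cases h : v = i
  · rw [h, outdegree_insert_self hi]
  · rw [outdegree_insert_of_ne h]
    exact hF.outdegree_le_one v

/-- A new arc at the root `i` changes nothing outside the tree of `i`;
`convergesTo_insert_of_convergesTo` is the complementary case, where the tree of `i` is grafted at
`m` and inherits the root of `m`. -/
lemma convergesTo_insert_of_not {F : Finset (V × V)} (hF : IsConvergingForest F) {i m : V}
    (hi : outdegree F i = 0) {v r : V} (hv : ¬ ConvergesTo F v i)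
    (hr : ConvergesTo F v r) : ConvergesTo (insert (i, m) F) v r := by
  obtain ⟨hvr, hr0⟩ := hF.convergesTo_iff.1 hr
  have hri : r ≠ i := fun h => hv (h ▸ hr)
  exact convergesTo_of_reaches (outdegree_insert_le_one hF hi)
    (reaches_mono (Finset.subset_insert _ _) hvr)
    (by rw [outdegree_insert_of_ne hri, hr0])

lemma convergesTo_insert_of_convergesTo {F : Finset (V × V)} (hF : IsConvergingForest F)
    {i m : V} (hi : outdegree F i = 0) (hm : ¬ ConvergesTo F m i) {v r : V}
    (hv : ConvergesTo F v i) (hr : ConvergesTo F m r) : ConvergesTo (insert (i, m) F) v r := by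
  have hmi := hF.convergesTo_iff.1 hv
  obtain ⟨hmr, hr0⟩ := hF.convergesTo_iff.1 hr
  have hri : r ≠ i := fun h => hm (h ▸ hr)
  refine convergesTo_of_reaches (outdegree_insert_le_one hF hi) ?_
    (by rw [outdegree_insert_of_ne hri, hr0])
  exact ((reaches_mono (Finset.subset_insert _ _) hmi.1).tail (Finset.mem_insert_self _ _)).trans
    (reaches_mono (Finset.subset_insert _ _) hmr)

lemma IsConvergingForest.insert {F : Finset (V × V)} (hF : IsConvergingForest F) {i m : V}
    (hi : outdegree F i = 0) (hm : ¬ ConvergesTo F m i) :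
    IsConvergingForest (insert (i, m) F) := by
  intro v
  by_cases hv : ConvergesTo F v i
  · obtain ⟨r, hr⟩ := hF m
    exact ⟨r, convergesTo_insert_of_convergesTo hF hi hm hv hr⟩
  · obtain ⟨r, hr⟩ := hF v
    exact ⟨r, convergesTo_insert_of_not hF hi hv hr⟩

lemma convergesTo_insert_iff_of_not {F : Finset (V × V)} (hF : IsConvergingForest F) {i m : V}
    (hi : outdegree F i = 0) {v : V} (hv : ¬ ConvergesTo F v i) (j : V) :
    ConvergesTo (insert (i, m) F) v j ↔ ConvergesTo F v j := by
  obtain ⟨r, hr⟩ := hF v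
  have hr' := convergesTo_insert_of_not (m := m) hF hi hv hr
  exact ⟨fun h => hr'.unique h ▸ hr, fun h => hr.unique h ▸ hr'⟩

lemma convergesTo_insert_iff_of_convergesTo {F : Finset (V × V)} (hF : IsConvergingForest F)
    {i m : V} (hi : outdegree F i = 0) (hm : ¬ ConvergesTo F m i) {v : V}
    (hv : ConvergesTo F v i) (j : V) :
    ConvergesTo (insert (i, m) F) v j ↔ ConvergesTo F m j := by
  obtain ⟨r, hr⟩ := hF m
  have hr' := convergesTo_insert_of_convergesTo hF hi hm hv hr
  exact ⟨fun h => hr'.unique h ▸ hr, fun h => hr.unique h ▸ hr'⟩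

lemma isConvergingForest_empty : IsConvergingForest (∅ : Finset (V × V)) :=
  isConvergingForest_of_reaches (fun v => by simp [outdegree])
    fun v => ⟨v, .refl, by simp [outdegree]⟩

/-- Each tree has exactly one root, and each other vertex is the tail of exactly one arc. -/
lemma IsConvergingForest.numComponents_add_card {F : Finset (V × V)}
    (hF : IsConvergingForest F) : numComponents F + F.card = Fintype.card V := by
  classical
  have hroots : numComponents F = (Finset.univ.filter fun v => outdegree F v = 0).card := by
    rw [numComponents]
    rw [← Finset.card_image_of_injOn (f := weakComponent F)
      (s := Finset.univ.filter fun v => outdegree F v = 0)]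
    · congr 1
      ext C
      simp only [Finset.mem_image, Finset.mem_univ, true_and, Finset.mem_filter]
      constructor
      · rintro ⟨v, rfl⟩
        obtain ⟨r, hr⟩ := hF v
        exact ⟨r, hr.2.1,
          weakComponent_eq_iff.2 (Relation.EqvGen.symm _ _ (mem_weakComponent.1 hr.1))⟩
      · rintro ⟨r, -, rfl⟩
        exact ⟨r, rfl⟩
    · intro r hr s hs hrs
      simp only [Finset.coe_filter, Finset.mem_univ, true_and, Set.mem_ofPred_eq] at hr hs
      have h := hF.convergesTo_self_iff.2 hr
      by_contra hne
      have := h.2.2 s (mem_weakComponent.2 (weakComponent_eq_iff.1 hrs)) (Ne.symm hne)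
      rw [hs] at this
      exact zero_ne_one this
  have harcs : F.card = (Finset.univ.filter fun v => ¬ outdegree F v = 0).card := by
    rw [Finset.card_eq_sum_card_fiberwise (f := Prod.fst) (t := Finset.univ)
      (fun _ _ => Finset.mem_coe.2 (Finset.mem_univ _)), Finset.card_filter]
    refine Finset.sum_congr rfl fun v _ => ?_
    have h1 := hF.outdegree_le_one v
    change outdegree F v = _
    split_ifs <;> omega
  rw [hroots, harcs, Finset.card_filter_add_card_filter_not, Finset.card_univ]

open Classical in
/-- Forests in which `i` is not a root arise uniquely from forests in which `i` is a root by adding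
an arc from `i` to a vertex of another tree. -/
lemma sum_forests_nonroot (i : V) (k : ℕ) (h : Finset (V × V) → ℝ) :
    ∑ G : Finset (V × V) with (IsConvergingForest G ∧ G.card = k + 1) ∧ outdegree G i ≠ 0, h G =
      ∑ F : Finset (V × V) with (IsConvergingForest F ∧ F.card = k) ∧ outdegree F i = 0,
        ∑ m with ¬ ConvergesTo F m i, h (insert (i, m) F) := by
  rw [Finset.sum_sigma']
  symm
  refine Finset.sum_bij (fun x _ => insert (i, x.2) x.1) ?_ ?_ ?_ (fun _ _ => rfl)
  · rintro ⟨F, m⟩ hx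
    simp only [Finset.mem_sigma, Finset.mem_filter, Finset.mem_univ, true_and] at hx ⊢
    obtain ⟨⟨⟨hF, hc⟩, hi⟩, hm⟩ := hx
    refine ⟨⟨hF.insert hi hm, ?_⟩, ?_⟩
    · rw [Finset.card_insert_of_notMem (outdegree_eq_zero_iff.1 hi m), hc]
    · rw [outdegree_insert_self hi]; exact one_ne_zero
  · rintro ⟨F, m⟩ hx ⟨F', m'⟩ hx' heq
    simp only [Finset.mem_sigma, Finset.mem_filter, Finset.mem_univ, true_and] at hx hx' heq
    have h1 := outdegree_eq_zero_iff.1 hx.1.2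
    have h2 := outdegree_eq_zero_iff.1 hx'.1.2
    have hm : m = m' := by
      have : (i, m) ∈ insert (i, m') F' := heq ▸ Finset.mem_insert_self _ _
      rcases Finset.mem_insert.1 this with h | h
      · exact congrArg Prod.snd h
      · exact absurd h (h2 m)
    subst hm
    have : F = F' := by
      rw [← Finset.erase_insert (h1 m), heq, Finset.erase_insert (h2 m)]
    rw [this]
  -- The preimage of `G` is obtained by deleting the arc that leaves `i`.
  · intro G hG
    simp only [Finset.mem_filter, Finset.mem_univ, true_and] at hG
    obtain ⟨⟨hG, hc⟩, hi⟩ := hG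
    obtain ⟨m, hm⟩ : ∃ m, (i, m) ∈ G := by
      by_contra! hcon
      exact hi (outdegree_eq_zero_iff.2 hcon)
    refine ⟨⟨G.erase (i, m), m⟩, ?_, Finset.insert_erase hm⟩
    simp only [Finset.mem_sigma, Finset.mem_filter, Finset.mem_univ, true_and]
    refine ⟨⟨⟨hG.erase hm, ?_⟩, hG.outdegree_erase hm⟩, hG.not_convergesTo_erase hm⟩
    rw [Finset.card_erase_of_mem hm, hc, Nat.add_sub_cancel]

end Forests

/-! ### The recurrence for forest matrices. -/

namespace WeightedDigraph

variable {V : Type*} (Γ : WeightedDigraph V)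

lemma subgraphWeight_pos [Fintype V] {F : Finset (V × V)} (hF : F ⊆ Γ.arcs) : 0 < Γ.subgraphWeight F :=
  Finset.prod_pos fun a ha => by simpa [arcs] using hF ha

lemma subgraphWeight_eq_zero [Fintype V] {F : Finset (V × V)} (hF : ¬ F ⊆ Γ.arcs) :
    Γ.subgraphWeight F = 0 := by
  obtain ⟨a, ha, ha'⟩ := Finset.not_subset.1 hF
  refine Finset.prod_eq_zero ha (le_antisymm ?_ (Γ.weight_nonneg _ _))
  simpa [arcs] using ha'

lemma subgraphWeight_insert [DecidableEq V] {F : Finset (V × V)} {i m : V} (hi : outdegree F i = 0) :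
    Γ.subgraphWeight (insert (i, m) F) = Γ.weight i m * Γ.subgraphWeight F :=
  Finset.prod_insert (outdegree_eq_zero_iff.1 hi m)

variable [Fintype V] [DecidableEq V]

lemma mem_inForests {F : Finset (V × V)} :
    F ∈ Γ.inForests ↔ F ⊆ Γ.arcs ∧ IsConvergingForest F := by
  simp [inForests]

open Classical in
/-- Subgraphs of the complete digraph that are not subgraphs of `Γ` have weight zero. -/
lemma sum_inForests_eq (k : ℕ) (f : Finset (V × V) → ℝ) :
    ∑ F ∈ Γ.inForests.filter (fun F => F.card = k), Γ.subgraphWeight F * f F =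
      ∑ F : Finset (V × V) with IsConvergingForest F ∧ F.card = k, Γ.subgraphWeight F * f F := by
  refine Finset.sum_subset (fun F hF => ?_) fun F hF hF' => ?_
  · simp only [Finset.mem_filter, mem_inForests, Finset.mem_univ, true_and] at hF ⊢
    exact ⟨hF.1.2, hF.2⟩
  · simp only [Finset.mem_filter, mem_inForests, Finset.mem_univ, true_and] at hF hF'
    rw [Γ.subgraphWeight_eq_zero fun h => hF' ⟨⟨h, hF.1⟩, hF.2⟩, zero_mul]

open Classical in
lemma sigma_eq (k : ℕ) : Γ.sigma k =
    ∑ F : Finset (V × V) with IsConvergingForest F ∧ F.card = k, Γ.subgraphWeight F := by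
  simpa [sigma] using Γ.sum_inForests_eq k fun _ => 1

open Classical in
lemma forestMatrix_apply (k : ℕ) (i j : V) : Γ.forestMatrix k i j =
    ∑ F : Finset (V × V) with IsConvergingForest F ∧ F.card = k,
      Γ.subgraphWeight F * if ConvergesTo F i j then 1 else 0 := by
  rw [← sum_inForests_eq, forestMatrix, Matrix.of_apply, ← Finset.filter_filter,
    Finset.sum_filter]
  simp only [mul_ite, mul_one, mul_zero]

lemma laplacian_mul_apply (A : Matrix V V ℝ) (i j : V) :
    (Γ.laplacian * A) i j = ∑ m, Γ.weight i m * (A i j - A m j) := by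
  rw [Matrix.mul_apply, ← Finset.add_sum_erase _ _ (Finset.mem_univ i),
    ← Finset.add_sum_erase Finset.univ (fun m => Γ.weight i m * (A i j - A m j))
      (Finset.mem_univ i)]
  simp only [laplacian, Matrix.of_apply, if_true, sub_self, mul_zero, zero_add, mul_sub,
    Finset.sum_sub_distrib, Finset.sum_mul]
  rw [sub_eq_add_neg, ← Finset.sum_neg_distrib]
  congr 1
  refine Finset.sum_congr rfl fun m hm => ?_
  rw [if_neg (Finset.ne_of_mem_erase hm), neg_mul]

open Classical in
/-- Forests in which `i` is not a root do not contribute to `L * Q_k`. -/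
lemma sum_nonroot_eq_zero (k : ℕ) (i j : V) :
    ∑ F : Finset (V × V) with (IsConvergingForest F ∧ F.card = k) ∧ outdegree F i ≠ 0,
      ∑ m, Γ.weight i m * (Γ.subgraphWeight F *
        ((if ConvergesTo F i j then 1 else 0) - if ConvergesTo F m j then 1 else 0)) = 0 := by
  -- For `k = 0` the only forest is empty, so every vertex is a root and the sum is empty.
  cases k with
  | zero =>
    refine Finset.sum_eq_zero fun F hF => ?_
    simp only [Finset.mem_filter, Finset.mem_univ, true_and, Finset.card_eq_zero] at hF
    obtain ⟨⟨-, rfl⟩, h⟩ := hF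
    simp [outdegree] at h
  | succ k =>
    rw [sum_forests_nonroot]
    refine Finset.sum_eq_zero fun F hF => ?_
    simp only [Finset.mem_filter, Finset.mem_univ, true_and] at hF
    obtain ⟨⟨hF, -⟩, hi⟩ := hF
    have hii := hF.convergesTo_self_iff.2 hi
    set c : V → ℝ := fun m => if ConvergesTo F m j then 1 else 0 with hc
    -- In `F + (i, m)`, both `i` and the vertices `l` of the old tree of `i` share the root of `m`,
    -- so such `l` contribute zero. For the other `l`, convergence is as in `F`.
    have hinner : ∀ m ∈ Finset.univ.filter (fun m => ¬ ConvergesTo F m i),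
        (∑ l, Γ.weight i l * (Γ.subgraphWeight (insert (i, m) F) *
          ((if ConvergesTo (insert (i, m) F) i j then 1 else 0) -
            if ConvergesTo (insert (i, m) F) l j then 1 else 0))) =
        ∑ l with ¬ ConvergesTo F l i,
          Γ.weight i l * Γ.weight i m * Γ.subgraphWeight F * (c m - c l) := by
      intro m hm
      simp only [Finset.mem_filter, Finset.mem_univ, true_and] at hm
      rw [Finset.sum_filter]
      refine Finset.sum_congr rfl fun l _ => ?_
      rw [Γ.subgraphWeight_insert hi]
      simp only [convergesTo_insert_iff_of_convergesTo hF hi hm hii]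
      by_cases hl : ConvergesTo F l i
      · simp only [convergesTo_insert_iff_of_convergesTo hF hi hm hl, hl, not_true_eq_false,
          if_false, sub_self, mul_zero]
      · simp only [convergesTo_insert_iff_of_not hF hi hl, hl, not_false_eq_true, if_true, hc]
        ring
    rw [Finset.sum_congr rfl hinner]
    -- The double sum runs over a symmetric range and its summand is antisymmetric in `m` and `l`:
    -- exchanging the arcs `(i, m)` and `(i, l)` reverses the sign. So the sum equals its own
    -- negative.
    have hanti : ∀ m l, Γ.weight i l * Γ.weight i m * Γ.subgraphWeight F * (c m - c l) =
        - (Γ.weight i m * Γ.weight i l * Γ.subgraphWeight F * (c l - c m)) := by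
      intro m l; ring
    have : ∀ x : ℝ, x = -x → x = 0 := fun x hx => by linarith
    apply this
    conv_lhs => rw [Finset.sum_comm]
    rw [← Finset.sum_neg_distrib]
    refine Finset.sum_congr rfl fun m _ => ?_
    rw [← Finset.sum_neg_distrib]
    exact Finset.sum_congr rfl fun l _ => hanti l m

/-- The recurrence `L Q_k = σ_{k+1} I - Q_{k+1}`. -/
lemma laplacian_mul_forestMatrix (k : ℕ) :
    Γ.laplacian * Γ.forestMatrix k = Γ.sigma (k + 1) • 1 - Γ.forestMatrix (k + 1) := by
  classical
  ext i j
  have hL : (Γ.laplacian * Γ.forestMatrix k) i j =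
      ∑ F : Finset (V × V) with IsConvergingForest F ∧ F.card = k,
        ∑ m, Γ.weight i m * (Γ.subgraphWeight F *
          ((if ConvergesTo F i j then 1 else 0) - if ConvergesTo F m j then 1 else 0)) := by
    rw [laplacian_mul_apply, Finset.sum_comm]
    refine Finset.sum_congr rfl fun m _ => ?_
    rw [forestMatrix_apply, forestMatrix_apply, ← Finset.sum_sub_distrib, Finset.mul_sum]
    exact Finset.sum_congr rfl fun F _ => by rw [mul_sub (Γ.subgraphWeight F)]
  have hR : (Γ.sigma (k + 1) • (1 : Matrix V V ℝ) - Γ.forestMatrix (k + 1)) i j =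
      ∑ F : Finset (V × V) with IsConvergingForest F ∧ F.card = k + 1,
        Γ.subgraphWeight F *
          ((if i = j then 1 else 0) - if ConvergesTo F i j then 1 else 0) := by
    rw [Matrix.sub_apply, Matrix.smul_apply, Matrix.one_apply, forestMatrix_apply, sigma_eq,
      smul_eq_mul, Finset.sum_mul, ← Finset.sum_sub_distrib]
    exact Finset.sum_congr rfl fun F _ => by rw [mul_sub (Γ.subgraphWeight F)]
  -- Both sides are split according to whether `i` is a root. The non-root part on the left and the
  -- root part on the right vanish; the two other parts match through `sum_forests_nonroot`.
  rw [hL, hR, ← Finset.sum_filter_add_sum_filter_not _ (fun F => outdegree F i = 0),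
    ← Finset.sum_filter_add_sum_filter_not (Finset.univ.filter fun F : Finset (V × V) =>
      IsConvergingForest F ∧ F.card = k + 1) (fun F => outdegree F i = 0)]
  simp only [Finset.filter_filter]
  rw [Γ.sum_nonroot_eq_zero k i j, add_zero, sum_forests_nonroot]
  rw [Finset.sum_eq_zero (s := Finset.univ.filter fun F : Finset (V × V) =>
    (IsConvergingForest F ∧ F.card = k + 1) ∧ outdegree F i = 0), zero_add]
  · refine Finset.sum_congr rfl fun F hF => ?_
    simp only [Finset.mem_filter, Finset.mem_univ, true_and] at hF
    obtain ⟨⟨hF, -⟩, hi⟩ := hF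
    rw [Finset.sum_filter]
    refine Finset.sum_congr rfl fun m _ => ?_
    simp only [hF.convergesTo_of_root hi]
    -- If `m` lies in the tree of `i`, the arc `(i, m)` would close a cycle; correspondingly the
    -- left term is zero, since `i` and `m` have the same root.
    by_cases hm : ConvergesTo F m i
    · rw [if_neg (not_not.2 hm)]
      have : ConvergesTo F m j ↔ i = j := ⟨fun h => hm.unique h, fun h => h ▸ hm⟩
      simp only [this, sub_self, mul_zero]
    · rw [if_pos hm, Γ.subgraphWeight_insert hi]
      simp only [convergesTo_insert_iff_of_convergesTo hF hi hm (hF.convergesTo_self_iff.2 hi)]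
      ring
  · intro F hF
    simp only [Finset.mem_filter, Finset.mem_univ, true_and] at hF
    simp only [hF.1.1.convergesTo_of_root hF.2, sub_self, mul_zero]

lemma forestMatrix_zero : Γ.forestMatrix 0 = 1 := by
  classical
  ext i j
  have : (Finset.univ.filter fun F : Finset (V × V) => IsConvergingForest F ∧ F.card = 0) = {∅} := by
    ext F
    simp only [Finset.mem_filter, Finset.mem_univ, true_and, Finset.card_eq_zero,
      Finset.mem_singleton]
    exact ⟨fun h => h.2, fun h => ⟨h ▸ isConvergingForest_empty, h⟩⟩
  rw [forestMatrix_apply, this, Finset.sum_singleton]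
  simp only [isConvergingForest_empty.convergesTo_of_root (i := i) (by simp [outdegree])]
  simp [subgraphWeight, Matrix.one_apply]

lemma sigma_zero : Γ.sigma 0 = 1 := by
  classical
  have : (Finset.univ.filter fun F : Finset (V × V) => IsConvergingForest F ∧ F.card = 0) = {∅} := by
    ext F
    simp only [Finset.mem_filter, Finset.mem_univ, true_and, Finset.card_eq_zero,
      Finset.mem_singleton]
    exact ⟨fun h => h.2, fun h => ⟨h ▸ isConvergingForest_empty, h⟩⟩
  rw [sigma_eq, this, Finset.sum_singleton]
  simp [subgraphWeight]

/-- By the recurrence, `Q_k` is a polynomial in `L`. -/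
lemma commute_laplacian_forestMatrix (k : ℕ) : Commute Γ.laplacian (Γ.forestMatrix k) := by
  induction k with
  | zero => rw [forestMatrix_zero]; exact Commute.one_right _
  | succ k ih =>
    have h : Γ.forestMatrix (k + 1) =
        Γ.sigma (k + 1) • 1 - Γ.laplacian * Γ.forestMatrix k := by
      rw [laplacian_mul_forestMatrix, sub_sub_cancel]
    rw [h]
    exact ((Commute.one_right _).smul_right _).sub_right ((Commute.refl _).mul_right ih)

/-! ### Maximum in-forests. -/

lemma exists_forest_numComponents : ∃ F ∈ Γ.inForests, numComponents F = Γ.inForestDimension :=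
  Nat.sInf_mem (s := {m | ∃ F ∈ Γ.inForests, numComponents F = m})
    ⟨_, ∅, Γ.mem_inForests.2 ⟨Finset.empty_subset _, isConvergingForest_empty⟩, rfl⟩

lemma sigma_max_pos : 0 < Γ.sigma (Fintype.card V - Γ.inForestDimension) := by
  obtain ⟨F, hF, hd⟩ := Γ.exists_forest_numComponents
  have hcard := (Γ.mem_inForests.1 hF).2.numComponents_add_card
  refine Finset.sum_pos (fun G hG => Γ.subgraphWeight_pos
    (Γ.mem_inForests.1 (Finset.mem_filter.1 hG).1).1) ⟨F, Finset.mem_filter.2 ⟨hF, ?_⟩⟩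
  omega

lemma card_le_of_mem_inForests {F : Finset (V × V)} (hF : F ∈ Γ.inForests) :
    F.card ≤ Fintype.card V - Γ.inForestDimension := by
  have hcard := (Γ.mem_inForests.1 hF).2.numComponents_add_card
  have hd : Γ.inForestDimension ≤ numComponents F := Nat.sInf_le ⟨F, hF, rfl⟩
  omega

lemma sigma_eq_zero {k : ℕ} (hk : Fintype.card V - Γ.inForestDimension < k) : Γ.sigma k = 0 := by
  rw [sigma, Finset.sum_eq_zero]
  intro F hF
  obtain ⟨hF', rfl⟩ := Finset.mem_filter.1 hF
  exact absurd (Γ.card_le_of_mem_inForests hF') (not_le.2 hk)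

lemma forestMatrix_eq_zero {k : ℕ} (hk : Fintype.card V - Γ.inForestDimension < k) :
    Γ.forestMatrix k = 0 := by
  classical
  ext i j
  rw [forestMatrix, Matrix.of_apply, Matrix.zero_apply]
  refine Finset.sum_eq_zero ?_
  intro F hF
  obtain ⟨hF', rfl, -⟩ := Finset.mem_filter.1 hF
  exact absurd (Γ.card_le_of_mem_inForests hF') (not_le.2 hk)

/-- At `k = n - d` the right-hand side of the recurrence involves only forests with too many arcs.
-/
lemma laplacian_mul_maxForestMatrix : Γ.laplacian * Γ.maxForestMatrix = 0 := by
  rw [maxForestMatrix, normalizedForestMatrix, Matrix.mul_smul, laplacian_mul_forestMatrix,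
    Γ.sigma_eq_zero (Nat.lt_succ_self _), Γ.forestMatrix_eq_zero (Nat.lt_succ_self _)]
  simp

lemma maxForestMatrix_mul_laplacian : Γ.maxForestMatrix * Γ.laplacian = 0 := by
  have h : Commute Γ.laplacian Γ.maxForestMatrix :=
    (Γ.commute_laplacian_forestMatrix _).smul_right _
  rw [← h.eq, laplacian_mul_maxForestMatrix]

/-- The columns of `I - J` lie in the range of `L`. -/
lemma exists_one_sub_maxForestMatrix_eq :
    ∃ N : Matrix V V ℝ, 1 - Γ.maxForestMatrix = Γ.laplacian * N := by
  have hpos := Γ.sigma_max_pos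
  rw [maxForestMatrix, normalizedForestMatrix]
  generalize Fintype.card V - Γ.inForestDimension = k at hpos
  cases k with
  -- If the maximum number of arcs is zero, then `J = I`.
  | zero => exact ⟨0, by simp [forestMatrix_zero, sigma_zero]⟩
  | succ k =>
    -- The recurrence one step below the maximum, divided by `σ_{k+1}`, gives this witness.
    refine ⟨(Γ.sigma (k + 1))⁻¹ • Γ.forestMatrix k, ?_⟩
    rw [Matrix.mul_smul, laplacian_mul_forestMatrix, smul_sub, smul_smul,
      inv_mul_cancel₀ hpos.ne', one_smul]

end WeightedDigraph

/-! ### Linear algebra: nonsingularity and the Penrose equations. -/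

section MoorePenrose

variable {𝕜 : Type*} [RCLike 𝕜] {m n : Type*} [Fintype m] [Fintype n]

/-- Taking adjoints of products of projections gives `A X = A Y` and `X A = Y A`; then `X = X A X =
Y A Y = Y`. -/
lemma IsMoorePenroseInverse.unique {A : Matrix m n 𝕜} {X Y : Matrix n m 𝕜}
    (hX : IsMoorePenroseInverse A X) (hY : IsMoorePenroseInverse A Y) : X = Y := by
  have h1 : A * X = A * Y := by
    calc A * X = (A * X)ᴴ := hX.conjTranspose_mul.symm
      _ = ((A * Y) * (A * X))ᴴ := by rw [← Matrix.mul_assoc, hY.mul_mul_self]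
      _ = (A * X) * (A * Y) := by
        rw [Matrix.conjTranspose_mul, hX.conjTranspose_mul, hY.conjTranspose_mul]
      _ = A * Y := by rw [← Matrix.mul_assoc, hX.mul_mul_self]
  have h2 : X * A = Y * A := by
    calc X * A = (X * A)ᴴ := hX.conjTranspose_mul_inv.symm
      _ = ((X * A) * (Y * A))ᴴ := by
        rw [Matrix.mul_assoc X A, ← Matrix.mul_assoc A Y, hY.mul_mul_self]
      _ = (Y * A) * (X * A) := by
        rw [Matrix.conjTranspose_mul, hX.conjTranspose_mul_inv, hY.conjTranspose_mul_inv]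
      _ = Y * A := by rw [Matrix.mul_assoc Y A, ← Matrix.mul_assoc A X, hX.mul_mul_self]
  rw [← hX.mul_mul_inv, h2, Matrix.mul_assoc, h1, ← Matrix.mul_assoc, hY.mul_mul_inv]

variable [DecidableEq n] {L J : Matrix n n 𝕜}

-- The adjoint `L* + J` is injective: on its kernel, applying `J*` kills the `L*` term, so `J* J x =
-- 0`, hence `J x = 0` and `L* x = 0`. Since `I - J` factors through `L`, its adjoint also kills
-- `x`.
open ComplexOrder in
lemma isUnit_add_conjTranspose (hLJ : L * J = 0) {N : Matrix n n 𝕜} (hN : 1 - J = L * N) :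
    IsUnit (L + Jᴴ) := by
  rw [← Matrix.isUnit_conjTranspose, ← Matrix.mulVec_injective_iff_isUnit]
  refine (injective_iff_map_eq_zero (Matrix.mulVecLin (L + Jᴴ)ᴴ)).2 fun x hx => ?_
  simp only [Matrix.mulVecLin_apply, Matrix.conjTranspose_add,
    Matrix.conjTranspose_conjTranspose, Matrix.add_mulVec] at hx
  have hJL : Jᴴ * Lᴴ = 0 := by
    rw [← Matrix.conjTranspose_mul, hLJ, Matrix.conjTranspose_zero]
  have hJJ : (Jᴴ * J) *ᵥ x = 0 := by
    have := congrArg (Jᴴ *ᵥ ·) hx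
    simpa [Matrix.mulVec_add, Matrix.mulVec_mulVec, hJL] using this
  have hJx : J *ᵥ x = 0 := (Matrix.conjTranspose_mul_self_mulVec_eq_zero J x).1 hJJ
  have hLx : Lᴴ *ᵥ x = 0 := by simpa [hJx] using hx
  have hxJ : x = Jᴴ *ᵥ x := by
    have h := congrArg (fun M => Mᴴ *ᵥ x) hN
    simp only [Matrix.conjTranspose_sub, Matrix.conjTranspose_one, Matrix.sub_mulVec,
      Matrix.one_mulVec, Matrix.conjTranspose_mul, ← Matrix.mulVec_mulVec, hLx,
      Matrix.mulVec_zero] at h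
    exact sub_eq_zero.1 h
  -- Here `x* x = (J* x)* x = x* (J x) = 0`.
  have hz : star x ⬝ᵥ x = 0 := by
    conv_lhs => rw [hxJ, Matrix.star_mulVec, Matrix.conjTranspose_conjTranspose,
      ← Matrix.dotProduct_mulVec, ← hxJ, hJx, dotProduct_zero]
  exact dotProduct_star_self_eq_zero.1 hz

/-- From `J L = 0` one gets `M L = L L* L`, and `M` commutes with `L L*`. So `L L* M⁻¹ = M⁻¹ L L*`
is Hermitian and fixes `L`; the other equations follow by taking adjoints. -/
lemma isMoorePenroseInverse_conjTranspose_mul_inv (hJL : J * L = 0)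
    (hM : IsUnit (Jᴴ * J + L * Lᴴ)) :
    IsMoorePenroseInverse L (Lᴴ * (Jᴴ * J + L * Lᴴ)⁻¹) := by
  set M := Jᴴ * J + L * Lᴴ with hMdef
  have hdet := (Matrix.isUnit_iff_isUnit_det _).1 hM
  have hMh : Mᴴ = M := by simp [hMdef]
  have hMih : M⁻¹ᴴ = M⁻¹ := by rw [Matrix.conjTranspose_nonsing_inv, hMh]
  have hLJ : Lᴴ * Jᴴ = 0 := by
    rw [← Matrix.conjTranspose_mul, hJL, Matrix.conjTranspose_zero]
  have hML : M * L = L * Lᴴ * L := by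
    rw [hMdef, Matrix.add_mul, Matrix.mul_assoc Jᴴ, hJL, Matrix.mul_zero, zero_add]
  have hcomm : Commute M (L * Lᴴ) := by
    change M * (L * Lᴴ) = L * Lᴴ * M
    rw [← Matrix.mul_assoc, hML, hMdef, Matrix.mul_add, Matrix.mul_assoc L Lᴴ (Jᴴ * J),
      ← Matrix.mul_assoc Lᴴ Jᴴ, hLJ, Matrix.zero_mul, Matrix.mul_zero, zero_add,
      Matrix.mul_assoc (L * Lᴴ)]
  have hcomm' : L * Lᴴ * M⁻¹ = M⁻¹ * (L * Lᴴ) := by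
    calc L * Lᴴ * M⁻¹ = M⁻¹ * (M * (L * Lᴴ)) * M⁻¹ := by
          rw [Matrix.nonsing_inv_mul_cancel_left _ _ hdet]
      _ = M⁻¹ * (L * Lᴴ) := by
          rw [hcomm.eq, Matrix.mul_assoc, Matrix.mul_nonsing_inv_cancel_right _ _ hdet]
  have h1 : L * Lᴴ * M⁻¹ * L = L := by
    rw [hcomm', Matrix.mul_assoc, ← hML, Matrix.nonsing_inv_mul_cancel_left _ _ hdet]
  have h2 : Lᴴ * M⁻¹ * (L * Lᴴ) = Lᴴ := by
    have := congrArg Matrix.conjTranspose h1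
    simpa [Matrix.conjTranspose_mul, hMih, Matrix.mul_assoc] using this
  refine ⟨by rw [← Matrix.mul_assoc, h1], ?_, ?_, ?_⟩
  · rw [← Matrix.mul_assoc, Matrix.mul_assoc _ L, h2]
  · rw [← Matrix.mul_assoc, Matrix.conjTranspose_mul, hMih, Matrix.conjTranspose_mul,
      Matrix.conjTranspose_conjTranspose, hcomm']
  · simp [Matrix.conjTranspose_mul, hMih, Matrix.mul_assoc]

end MoorePenrose

/-- `Z = L + J̃*` is nonsingular, and the Moore–Penrose inverse of `L`, that is, the one and only
matrix that satisfies the four defining equations, is `L*(ZZ*)⁻¹ = L*(J̃*J̃ + LL*)⁻¹`. The real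
matrices `L` and `J̃` are read over `𝕜 = ℝ` or `𝕜 = ℂ`. -/
theorem proposition16 {𝕜 : Type*} [RCLike 𝕜] {V : Type*} [Fintype V] [DecidableEq V]
    (Γ : WeightedDigraph V) :
    let L : Matrix V V 𝕜 := Γ.laplacian.map (algebraMap ℝ 𝕜)
    let J : Matrix V V 𝕜 := Γ.maxForestMatrix.map (algebraMap ℝ 𝕜)
    let Z : Matrix V V 𝕜 := L + Jᴴ
    IsUnit Z ∧ IsUnit (Z * Zᴴ) ∧ IsUnit (Jᴴ * J + L * Lᴴ) ∧
      (∀ X : Matrix V V 𝕜, IsMoorePenroseInverse L X ↔ X = Lᴴ * (Z * Zᴴ)⁻¹) ∧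
      (∀ X : Matrix V V 𝕜, IsMoorePenroseInverse L X ↔ X = Lᴴ * (Jᴴ * J + L * Lᴴ)⁻¹) := by
  intro L J Z
  have hLJ : L * J = 0 := by
    simp only [L, J]
    rw [← Matrix.map_mul, Γ.laplacian_mul_maxForestMatrix, Matrix.map_zero _ (map_zero _)]
  have hJL : J * L = 0 := by
    simp only [L, J]
    rw [← Matrix.map_mul, Γ.maxForestMatrix_mul_laplacian, Matrix.map_zero _ (map_zero _)]
  obtain ⟨N, hN⟩ := Γ.exists_one_sub_maxForestMatrix_eq
  have hN' : 1 - J = L * N.map (algebraMap ℝ 𝕜) := by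
    simp only [L, J]
    rw [← Matrix.map_mul, ← hN, Matrix.map_sub _ (map_sub _),
      Matrix.map_one _ (map_zero _) (map_one _)]
  have hZ : IsUnit Z := isUnit_add_conjTranspose hLJ hN'
  -- The cross terms are `L J` and its adjoint, both zero.
  have hZZ : Z * Zᴴ = Jᴴ * J + L * Lᴴ := by
    have hJL' : Jᴴ * Lᴴ = 0 := by
      rw [← Matrix.conjTranspose_mul, hLJ, Matrix.conjTranspose_zero]
    simp only [Z, Matrix.conjTranspose_add, Matrix.conjTranspose_conjTranspose, Matrix.add_mul,
      Matrix.mul_add, hLJ, hJL', add_zero, zero_add]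
    exact add_comm _ _
  have hZZu : IsUnit (Z * Zᴴ) := hZ.mul ((Matrix.isUnit_conjTranspose Z).2 hZ)
  have hMu : IsUnit (Jᴴ * J + L * Lᴴ) := hZZ ▸ hZZu
  have hMP := isMoorePenroseInverse_conjTranspose_mul_inv hJL hMu
  have hiff (X : Matrix V V 𝕜) :
      IsMoorePenroseInverse L X ↔ X = Lᴴ * (Jᴴ * J + L * Lᴴ)⁻¹ :=
    ⟨fun hX => hX.unique hMP, fun hX => hX ▸ hMP⟩
  exact ⟨hZ, hZZu, hMu, fun X => by rw [hZZ]; exact hiff X, hiff⟩
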